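/- There is a universal constant $C>0$ such that the following holds. Let $D\subset\mathbb{R}^d$ be compact, let $x_1,\dots,x_m\in D$ satisfy $\|x_j-x_{j'}\|_2\ge\kappa$ for all $j\ne j'$, where $\kappa>0$, and let $\sigma,\nu>0$ and $\delta,\eta\in(0,1)$. Let $\omega_1,\dots,\omega_N$ be i.i.d. random vectors in $\mathbb{R}^d$ with the multivariate Student's $t$ distribution centered at $0$ with scale $\sigma$ and $\nu$ degrees of freedom, i.e. with density $$\rho(\omega)=\frac{\Gamma\left(\frac{\nu+d}{2}\right)}{\sigma^d\pi^{d/2}\nu^{d/2}\Gamma\left(\frac{\nu}{2}\right)}\left(1+\frac{1}{\sigma^2\nu}\|\omega\|_2^2\right)^{-\frac{\nu+d}{2}},$$ and let $A\in\mathbb{C}^{m\times N}$ be the matrix with entries $A_{j,k}=\exp(i\langle\omega_k,x_j\rangle)$. Suppose that $$N\ge C\eta^{-2}m\log\left(\frac{2m}{\delta}\right)\qquad\text{and}\qquad \frac{(\sigma\sqrt{\nu}\,\kappa)^{\nu/2}}{2^{\nu/2-1}\Gamma\left(\frac{\nu}{2}\right)}K_{\nu/2}(\sigma\sqrt{\nu}\,\kappa)\le\frac{\eta}{m},$$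 where $K_{\alpha}(x)=\int_0^\infty e^{-x\cosh t}\cosh(\alpha t)\,dt$ (for $x>0$) is the modified Bessel function of the second kind. Then, with probability at least $1-\delta$, $$\left\|\frac1N AA^*-I_m\right\|_2\le 2\eta,$$ where $\|\cdot\|_2$ is the spectral norm. -/

import Mathlib

open scoped Matrix.Norms.L2Operator

/-- The modified Bessel function of the second kind `K_α`, of real order `α`, at a positive real
argument `x`: `K_α(x) = ∫₀^∞ exp(-x cosh t) cosh(α t) dt`. -/
noncomputable def besselK (α x : ℝ) : ℝ :=
  ∫ t in Set.Ioi (0 : ℝ), Real.exp (-x * Real.cosh t) * Real.cosh (α * t)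

/-- The radial profile of the Matérn kernel with scale `σ` and smoothness `ν / 2`, as a function of
the distance `r > 0`. -/
noncomputable def maternProfile (σ ν r : ℝ) : ℝ :=
  (σ * Real.sqrt ν * r) ^ (ν / 2) / ((2 : ℝ) ^ (ν / 2 - 1) * Real.Gamma (ν / 2))
    * besselK (ν / 2) (σ * Real.sqrt ν * r)

/-- The density, with respect to Lebesgue measure on `ℝ^d`, of the multivariate Student's t
distribution centered at `0` with scale `σ` and `ν` degrees of freedom. -/
noncomputable def studentTDensity (d : ℕ) (σ ν : ℝ) (w : EuclideanSpace ℝ (Fin d)) : ℝ :=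
  Real.Gamma ((ν + d) / 2)
    / (σ ^ d * Real.pi ^ ((d : ℝ) / 2) * ν ^ ((d : ℝ) / 2) * Real.Gamma (ν / 2))
    * (1 + 1 / (σ ^ 2 * ν) * ‖w‖ ^ 2) ^ (-((ν + d) / 2))

/-- The multivariate Student's t distribution on `ℝ^d`. -/
noncomputable def studentT (d : ℕ) (σ ν : ℝ) : MeasureTheory.Measure (EuclideanSpace ℝ (Fin d)) :=
  MeasureTheory.volume.withDensity (fun w => ENNReal.ofReal (studentTDensity d σ ν w))

/-- The random Fourier feature matrix `A_{j,k} = exp(i ⟨w_k, x_j⟩)` with `m` data points `x_j` and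
`N` frequencies `w_k`. -/
noncomputable def featureMatrix {d m N : ℕ} (x : Fin m → EuclideanSpace ℝ (Fin d))
    (w : Fin N → EuclideanSpace ℝ (Fin d)) : Matrix (Fin m) (Fin N) ℂ :=
  Matrix.of fun j k => Complex.exp (Complex.I * ((inner ℝ (w k) (x j) : ℝ) : ℂ))

/-! Write `A * Aᴴ` as a sum of i.i.d. Hermitian matrices `Y (ω k)` with `Y * Y = m • Y`, and split
`A * Aᴴ / N - 1` into a bias `M - 1`, where `M` is the mean of `Y`, and a fluctuation. Each part
costs `η`.

Bias: the Student density is a Gamma mixture of Gaussians, so its characteristic function is the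
Matérn profile (`integral_studentT_cexp`), which decreases in the distance. Off-diagonal entries of
`M` are thus at most `η / m` and diagonal entries are 1.

Fluctuation: matrix concentration by exchangeable pairs. Let `S` be the centered sum and `f t = E tr
exp (t S)`. Resampling one frequency symmetrizes each summand of `f'`; the trace inequality
`reTrace_sub_mul_exp_sub_exp_le` and `Y * Y = R • Y` then give `t f' ≤ t² R (f' + 2 c N f)` when `M
≤ c`. For `|t| R ≤ 1/2` this integrates to a subgaussian bound on `f`, and Markov's inequality
finishes. -/

/-! ### Trace inequalities for matrix exponentials. -/

section TraceInequalities

open Matrix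
open scoped ComplexOrder

variable {n : Type*} [Fintype n]

/-- The real part of the trace, as a continuous real-linear functional. -/
noncomputable def reTrace : Matrix n n ℂ →L[ℝ] ℝ :=
  LinearMap.toContinuousLinearMap (Complex.reLm ∘ₗ (Matrix.traceLinearMap n ℝ ℂ))

lemma reTrace_apply (A : Matrix n n ℂ) : reTrace A = A.trace.re := rfl

lemma reTrace_mul_comm (A B : Matrix n n ℂ) : reTrace (A * B) = reTrace (B * A) := by
  rw [reTrace_apply, reTrace_apply, trace_mul_comm]

lemma reTrace_nonneg {A : Matrix n n ℂ} (hA : A.PosSemidef) : 0 ≤ reTrace A :=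
  (Complex.le_def.1 hA.trace_nonneg).1

variable [DecidableEq n]

lemma Matrix.IsHermitian.exists_diagonalization {A : Matrix n n ℂ} (hA : A.IsHermitian) :
    ∃ (U : Matrix n n ℂ) (a : n → ℝ), Uᴴ * U = 1 ∧ U * Uᴴ = 1 ∧
      A = U * diagonal (fun i => (a i : ℂ)) * Uᴴ := by
  refine ⟨hA.eigenvectorUnitary, hA.eigenvalues, ?_, ?_, ?_⟩
  · exact Unitary.coe_star_mul_self _
  · exact Unitary.coe_mul_star_self _
  · exact hA.spectral_theorem

lemma exp_conj_diagonal {U : Matrix n n ℂ} (h1 : Uᴴ * U = 1) (h2 : U * Uᴴ = 1) (a : n → ℝ) :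
    NormedSpace.exp (U * diagonal (fun i => (a i : ℂ)) * Uᴴ)
      = U * diagonal (fun i => ((Real.exp (a i) : ℝ) : ℂ)) * Uᴴ := by
  have := Matrix.exp_units_conj (⟨U, Uᴴ, h2, h1⟩ : (Matrix n n ℂ)ˣ) (diagonal (fun i => (a i : ℂ)))
  simp only [Units.inv_mk] at this
  rw [this, Matrix.exp_diagonal]
  congr 3
  ext i
  rw [Pi.coe_exp, ← Complex.exp_eq_exp_ℂ, Complex.ofReal_exp]

lemma conj_diagonal_mul_conj_diagonal {U : Matrix n n ℂ} (h1 : Uᴴ * U = 1) (f g : n → ℂ) :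
    (U * diagonal f * Uᴴ) * (U * diagonal g * Uᴴ) = U * diagonal (fun i => f i * g i) * Uᴴ := by
  rw [← diagonal_mul_diagonal]
  calc _ = U * diagonal f * (Uᴴ * U) * diagonal g * Uᴴ := by simp only [Matrix.mul_assoc]
    _ = _ := by rw [h1]; simp only [Matrix.mul_assoc, Matrix.one_mul]

/-- The weights are squared overlaps of two eigenbases. As they are nonnegative, trace inequalities
for noncommuting pairs reduce to scalar inequalities between eigenvalues. -/
lemma reTrace_conj_diagonal_mul (U V : Matrix n n ℂ) (f g : n → ℝ) :
    reTrace ((U * diagonal (fun i => (f i : ℂ)) * Uᴴ) * (V * diagonal (fun i => (g i : ℂ)) * Vᴴ))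
      = ∑ i, ∑ j, f i * g j * Complex.normSq ((Uᴴ * V) i j) := by
  have : (U * diagonal (fun i => (f i : ℂ)) * Uᴴ) * (V * diagonal (fun i => (g i : ℂ)) * Vᴴ)
      = U * (diagonal (fun i => (f i : ℂ)) * (Uᴴ * V) * diagonal (fun i => (g i : ℂ)) * Vᴴ) := by
    simp only [Matrix.mul_assoc]
  rw [this, reTrace_mul_comm]
  have : diagonal (fun i => (f i : ℂ)) * (Uᴴ * V) * diagonal (fun i => (g i : ℂ)) * Vᴴ * U
      = diagonal (fun i => (f i : ℂ)) * (Uᴴ * V) * diagonal (fun i => (g i : ℂ)) * (Uᴴ * V)ᴴ := by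
    simp only [Matrix.mul_assoc, conjTranspose_mul, conjTranspose_conjTranspose]
  rw [this, reTrace_apply, trace, Complex.re_sum]
  refine Finset.sum_congr rfl fun i _ => ?_
  rw [diag_apply, mul_apply, Complex.re_sum]
  refine Finset.sum_congr rfl fun j _ => ?_
  rw [mul_diagonal, diagonal_mul, conjTranspose_apply, Complex.star_def]
  have : (f i : ℂ) * (Uᴴ * V) i j * (g j : ℂ) * (starRingEnd ℂ) ((Uᴴ * V) i j)
      = ((f i * g j * Complex.normSq ((Uᴴ * V) i j) : ℝ) : ℂ) := by
    push_cast
    rw [← Complex.mul_conj]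
    ring
  rw [this, Complex.ofReal_re]

/-- By convexity, the trapezoid rule overestimates the integral of `exp` between `b` and `a`. -/
lemma Real.sub_mul_exp_sub_exp_le (a b : ℝ) :
    (a - b) * (Real.exp a - Real.exp b) ≤ (a - b) ^ 2 * (Real.exp a + Real.exp b) / 2 := by
  have key : ∀ x : ℝ, 0 ≤ x → Real.exp x - 1 ≤ x / 2 * (Real.exp x + 1) := by
    have hd : ∀ x : ℝ, HasDerivAt (fun x : ℝ => x / 2 * (Real.exp x + 1) - (Real.exp x - 1))
        ((1 / 2) * (Real.exp x + 1) + x / 2 * Real.exp x - Real.exp x) x := fun x =>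
      (((hasDerivAt_id x).div_const 2).mul ((Real.hasDerivAt_exp x).add_const 1)).sub
        ((Real.hasDerivAt_exp x).sub_const 1)
    have hm : Monotone (fun x : ℝ => x / 2 * (Real.exp x + 1) - (Real.exp x - 1)) := by
      refine monotone_of_deriv_nonneg (fun x => (hd x).differentiableAt) fun x => ?_
      rw [(hd x).deriv]
      have h1 := Real.add_one_le_exp (-x)
      have h2 : Real.exp x * Real.exp (-x) = 1 := by rw [← Real.exp_add]; simp
      nlinarith [Real.exp_pos x]
    intro x hx
    have := hm hx
    simp at this
    linarith
  wlog h : b ≤ a generalizing a b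
  · have := this b a (le_of_not_ge h)
    linarith [this]
  have h1 := key (a - b) (sub_nonneg.2 h)
  have h2 : Real.exp a = Real.exp (a - b) * Real.exp b := by rw [← Real.exp_add]; simp
  have h3 := mul_le_mul_of_nonneg_left h1 (mul_nonneg (sub_nonneg.2 h) (Real.exp_pos b).le)
  rw [h2]
  linarith

/-- Mean value inequality for the trace exponential. -/
lemma reTrace_sub_mul_exp_sub_exp_le {A B : Matrix n n ℂ} (hA : A.IsHermitian)
    (hB : B.IsHermitian) :
    reTrace ((A - B) * (NormedSpace.exp A - NormedSpace.exp B))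
      ≤ reTrace ((A - B) ^ 2 * (NormedSpace.exp A + NormedSpace.exp B)) / 2 := by
  obtain ⟨U, a, hU1, hU2, rfl⟩ := hA.exists_diagonalization
  obtain ⟨V, b, hV1, hV2, rfl⟩ := hB.exists_diagonalization
  rw [exp_conj_diagonal hU1 hU2, exp_conj_diagonal hV1 hV2]
  set F : (n → ℝ) → Matrix n n ℂ := fun f => U * diagonal (fun i => (f i : ℂ)) * Uᴴ with hF
  set G : (n → ℝ) → Matrix n n ℂ := fun f => V * diagonal (fun i => (f i : ℂ)) * Vᴴ with hG
  have hFF : ∀ f g, F f * F g = F (f * g) := fun f g => by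
    simp only [hF, conj_diagonal_mul_conj_diagonal hU1]; simp
  have hGG : ∀ f g, G f * G g = G (f * g) := fun f g => by
    simp only [hG, conj_diagonal_mul_conj_diagonal hV1]; simp
  have hF1 : F 1 = 1 := by simp [hF, hU2]
  have hG1 : G 1 = 1 := by simp [hG, hV2]
  have hFG : ∀ f g, reTrace (F f * G g) = ∑ i, ∑ j, f i * g j * Complex.normSq ((Uᴴ * V) i j) :=
    fun f g => reTrace_conj_diagonal_mul U V f g
  change reTrace ((F a - G b) * (F (fun i => Real.exp (a i)) - G (fun i => Real.exp (b i))))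
    ≤ reTrace ((F a - G b) ^ 2 * (F (fun i => Real.exp (a i)) + G (fun i => Real.exp (b i)))) / 2
  clear_value F G
  set p : n → ℝ := fun i => Real.exp (a i) with hp
  set q : n → ℝ := fun i => Real.exp (b i) with hq
  -- Padding with `F 1 = G 1 = 1` and using cyclicity puts every term in the form `F f * G g`, where
  -- `hFG` applies.
  have e1 : reTrace ((F a - G b) * (F p - G q)) = reTrace (F (a * p) * G 1) - reTrace (F a * G q)
      - reTrace (F p * G b) + reTrace (F 1 * G (b * q)) := by
    rw [hF1, hG1, ← hFF, ← hGG, reTrace_mul_comm (F p) (G b)]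
    simp only [← map_sub, ← map_add]
    congr 1
    noncomm_ring
  have e2 : reTrace ((F a - G b) ^ 2 * (F p + G q)) =
      reTrace (F (a * a * p) * G 1) - 2 * reTrace (F (a * p) * G b) + reTrace (F p * G (b * b))
      + reTrace (F (a * a) * G q) - 2 * reTrace (F a * G (b * q))
      + reTrace (F 1 * G (b * b * q)) := by
    have x1 : reTrace (F (a * p) * G b) = reTrace (F a * G b * F p) := by
      rw [reTrace_mul_comm (F a * G b), ← Matrix.mul_assoc, hFF, mul_comm p a]
    have x2 : reTrace (F (a * p) * G b) = reTrace (G b * F a * F p) := by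
      rw [Matrix.mul_assoc, hFF, reTrace_mul_comm]
    have x3 : reTrace (F a * G (b * q)) = reTrace (F a * G b * G q) := by
      rw [Matrix.mul_assoc, hGG]
    have x4 : reTrace (F a * G (b * q)) = reTrace (G b * F a * G q) := by
      rw [reTrace_mul_comm (G b * F a), ← Matrix.mul_assoc, hGG, mul_comm q b, reTrace_mul_comm]
    have x5 : reTrace (F p * G (b * b)) = reTrace (G b * G b * F p) := by
      rw [reTrace_mul_comm, hGG]
    rw [two_mul, two_mul, x5]
    nth_rewrite 1 [x1]
    nth_rewrite 1 [x2]
    nth_rewrite 1 [x3]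
    nth_rewrite 1 [x4]
    rw [hF1, hG1, ← hFF, ← hGG, ← hFF, ← hGG]
    simp only [← map_sub, ← map_add]
    congr 1
    noncomm_ring
  rw [e1, e2]
  simp only [hFG]
  have : ∀ i j, (a i - b j) * (p i - q j) * Complex.normSq ((Uᴴ * V) i j) ≤
      (a i - b j) ^ 2 * (p i + q j) / 2 * Complex.normSq ((Uᴴ * V) i j) := fun i j =>
    mul_le_mul_of_nonneg_right (Real.sub_mul_exp_sub_exp_le _ _) (Complex.normSq_nonneg _)
  have := Finset.sum_le_sum fun i (_ : i ∈ Finset.univ) =>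
    Finset.sum_le_sum fun j (_ : j ∈ Finset.univ) => this i j
  refine le_trans (le_of_eq ?_) (this.trans (le_of_eq ?_))
  · simp only [← Finset.sum_sub_distrib, ← Finset.sum_add_distrib]
    refine Finset.sum_congr rfl fun i _ => Finset.sum_congr rfl fun j _ => ?_
    simp only [Pi.mul_apply, Pi.one_apply]
    ring
  · simp only [Finset.mul_sum, ← Finset.sum_sub_distrib, ← Finset.sum_add_distrib, Finset.sum_div]
    refine Finset.sum_congr rfl fun i _ => Finset.sum_congr rfl fun j _ => ?_
    simp only [Pi.mul_apply, Pi.one_apply]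
    ring

omit [Fintype n] [DecidableEq n] in
lemma isHermitian_real_smul {A : Matrix n n ℂ} (hA : A.IsHermitian) (t : ℝ) :
    (t • A).IsHermitian := hA.smul (IsSelfAdjoint.all t)

lemma mul_reTrace_sub_mul_exp_sub_exp_le {A B : Matrix n n ℂ} (hA : A.IsHermitian)
    (hB : B.IsHermitian) (t : ℝ) :
    t * reTrace ((A - B) * (NormedSpace.exp (t • A) - NormedSpace.exp (t • B)))
      ≤ t ^ 2 * reTrace ((A - B) ^ 2 * (NormedSpace.exp (t • A) + NormedSpace.exp (t • B))) / 2 := by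
  have := reTrace_sub_mul_exp_sub_exp_le (isHermitian_real_smul hA t) (isHermitian_real_smul hB t)
  rw [← smul_sub, smul_pow, smul_mul_assoc, smul_mul_assoc, map_smul, map_smul] at this
  simpa [smul_eq_mul] using this

lemma exists_isHermitian_exp_eq_mul_self {A : Matrix n n ℂ} (hA : A.IsHermitian) :
    ∃ Q : Matrix n n ℂ, Q.IsHermitian ∧ NormedSpace.exp A = Q * Q := by
  refine ⟨NormedSpace.exp ((1 / 2 : ℝ) • A), (isHermitian_real_smul hA _).exp, ?_⟩
  rw [← Matrix.exp_add_of_commute _ _ (Commute.refl _), ← add_smul]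
  norm_num

lemma reTrace_mul_exp_nonneg {A P : Matrix n n ℂ} (hA : A.IsHermitian) (hP : P.PosSemidef) :
    0 ≤ reTrace (P * NormedSpace.exp A) := by
  obtain ⟨Q, hQ, h⟩ := exists_isHermitian_exp_eq_mul_self hA
  rw [h, ← Matrix.mul_assoc, reTrace_mul_comm, ← Matrix.mul_assoc]
  have := hP.mul_mul_conjTranspose_same Q
  rw [hQ.eq] at this
  exact reTrace_nonneg this

/-- The norm is some `|a i|`, an eigenvalue of `A` or of `-A`, and all other terms of the two traces
are positive. -/
lemma exp_norm_le_reTrace_exp_add {A : Matrix n n ℂ} [Nonempty n] (hA : A.IsHermitian) :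
    Real.exp ‖A‖ ≤ reTrace (NormedSpace.exp A) + reTrace (NormedSpace.exp (-A)) := by
  obtain ⟨U, a, hU1, hU2, rfl⟩ := hA.exists_diagonalization
  have hn : ‖U * diagonal (fun i => (a i : ℂ)) * Uᴴ‖ = ‖a‖ := by
    have h1 : (U : Matrix n n ℂ) ∈ unitary (Matrix n n ℂ) := ⟨hU1, hU2⟩
    have h2 : Uᴴ ∈ unitary (Matrix n n ℂ) := Unitary.star_mem h1
    rw [CStarRing.norm_mul_mem_unitary _ h2, CStarRing.norm_mem_unitary_mul _ h1,
      l2_opNorm_diagonal]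
    simp [Pi.norm_def]
  have hneg : -(U * diagonal (fun i => (a i : ℂ)) * Uᴴ)
      = U * diagonal (fun i => ((-a i : ℝ) : ℂ)) * Uᴴ := by
    rw [← Matrix.neg_mul, ← Matrix.mul_neg, diagonal_neg]
    simp
  have htr : ∀ f : n → ℝ, reTrace (U * diagonal (fun i => (f i : ℂ)) * Uᴴ) = ∑ i, f i := fun f => by
    rw [reTrace_mul_comm, ← Matrix.mul_assoc, hU1, Matrix.one_mul, reTrace_apply, trace_diagonal]
    simp
  rw [hneg, exp_conj_diagonal hU1 hU2, exp_conj_diagonal hU1 hU2, hn, htr, htr,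
    ← Finset.sum_add_distrib]
  obtain ⟨i, hi⟩ : ∃ i, ‖a‖ = |a i| := by
    obtain ⟨i, -, hi⟩ := Finset.exists_mem_eq_sup' (s := Finset.univ)
      (Finset.univ_nonempty (α := n)) (fun i => ‖a i‖₊)
    refine ⟨i, ?_⟩
    rw [Pi.norm_def, ← Finset.sup'_eq_sup Finset.univ_nonempty, hi]
    rfl
  rw [hi]
  refine le_trans ?_ (Finset.single_le_sum (f := fun i => Real.exp (a i) + Real.exp (-a i))
    (fun j _ => by positivity) (Finset.mem_univ i))
  rcases abs_cases (a i) with h | h <;> rw [h.1]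
  · linarith [Real.exp_pos (-a i)]
  · linarith [Real.exp_pos (a i)]

end TraceInequalities

/-! ### Resampling one coordinate. -/

section Concentration

open Matrix MeasureTheory
open scoped ComplexOrder

/-- Replacing one coordinate by an independent copy preserves the product law, so one can condition
on the other coordinates. -/
lemma measurePreserving_update_prod {ι E : Type*} [Fintype ι] [DecidableEq ι] [MeasurableSpace E]
    (μ : Measure E) [IsProbabilityMeasure μ] (k : ι) :
    MeasurePreserving (fun p : (ι → E) × E => Function.update p.1 k p.2)
      ((Measure.pi fun _ => μ).prod μ) (Measure.pi fun _ => μ) := by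
  have hmeas : Measurable (fun p : (ι → E) × E => Function.update p.1 k p.2) := by
    refine measurable_pi_lambda _ fun j => ?_
    by_cases h : j = k
    · subst h; simpa using measurable_snd
    · simpa [Function.update_of_ne h] using! (measurable_pi_apply j).comp measurable_fst
  refine ⟨hmeas, ?_⟩
  refine (Measure.pi_eq fun s hs => ?_).symm
  rw [Measure.map_apply hmeas (MeasurableSet.univ_pi hs)]
  have : (fun p : (ι → E) × E => Function.update p.1 k p.2) ⁻¹' Set.univ.pi s
      = (Set.univ.pi (Function.update s k Set.univ)) ×ˢ s k := by
    ext p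
    simp only [Set.mem_preimage, Set.mem_univ_pi, Set.mem_prod]
    constructor
    · refine fun h => ⟨fun j => ?_, by simpa using h k⟩
      by_cases hj : j = k
      · subst hj; simp
      · simpa [Function.update_of_ne hj] using h j
    · rintro ⟨h, hk⟩ j
      by_cases hj : j = k
      · subst hj; simpa using hk
      · simpa [Function.update_of_ne hj] using h j
  rw [this, Measure.prod_prod, Measure.pi_pi, ← Finset.mul_prod_erase _ _ (Finset.mem_univ k),
    ← Finset.mul_prod_erase _ (fun i => μ (s i)) (Finset.mem_univ k)]
  simp only [Function.update_self, measure_univ, one_mul]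
  rw [mul_comm]
  congr 1
  refine Finset.prod_congr rfl fun j hj => ?_
  rw [Function.update_of_ne (Finset.ne_of_mem_erase hj)]

lemma integrable_continuous_comp_of_bounded {Ω X F : Type*} [MeasurableSpace Ω] {P : Measure Ω}
    [IsFiniteMeasure P] [NormedAddCommGroup X] [ProperSpace X] [NormedAddCommGroup F]
    {f : X → F} (hf : Continuous f)
    {U : Ω → X} (hU : StronglyMeasurable U) {B : ℝ} (hB : ∀ s, ‖U s‖ ≤ B) :
    Integrable (fun s => f (U s)) P := by
  obtain ⟨C, hC⟩ := (isCompact_closedBall (0 : X) B).exists_bound_of_continuousOn hf.continuousOn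
  exact Integrable.of_bound (hf.comp_stronglyMeasurable hU).aestronglyMeasurable C
    (Filter.Eventually.of_forall fun s => hC _ (by simpa using hB s))

lemma integrable_continuous_comp_prodMk_of_bounded {Ω X F : Type*} [MeasurableSpace Ω]
    {P : Measure Ω} [IsFiniteMeasure P] [NormedAddCommGroup X] [ProperSpace X]
    [NormedAddCommGroup F] {f : X → X → F} (hf : Continuous fun p : X × X => f p.1 p.2)
    {U V : Ω → X} (hU : StronglyMeasurable U) (hV : StronglyMeasurable V) {B B' : ℝ}
    (hB : ∀ s, ‖U s‖ ≤ B) (hB' : ∀ s, ‖V s‖ ≤ B') :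
    Integrable (fun s => f (U s) (V s)) P := by
  refine integrable_continuous_comp_of_bounded (B := max B B') hf (hU.prodMk hV) fun s => ?_
  rw [Prod.norm_def]
  exact max_le_max (hB s) (hB' s)

variable {n : Type*} [Fintype n] [DecidableEq n]

instance : ProperSpace (Matrix n n ℂ) := FiniteDimensional.proper ℂ _

lemma continuous_matrix_exp : Continuous (NormedSpace.exp : Matrix n n ℂ → Matrix n n ℂ) :=
  letI : NormedAlgebra ℚ (Matrix n n ℂ) := NormedAlgebra.restrictScalars ℚ ℂ _
  NormedSpace.exp_continuous

variable {E : Type*} [MeasurableSpace E] {μ : Measure E} [IsProbabilityMeasure μ]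
  {Y : E → Matrix n n ℂ} {B R : ℝ}

/-- Dropping a positive square gives `(Y₁ - Y₂)² ≤ (Y₁ - Y₂)² + (Y₁ + Y₂)² = 2 (Y₁² + Y₂²) = 2 R (Y₁
+ Y₂)`, so the quadratic term becomes linear in the matrices. -/
lemma exchangeable_pair_trace_bound {S Y₁ Y₂ : Matrix n n ℂ} (hS : S.IsHermitian)
    (h₁ : Y₁.IsHermitian) (h₂ : Y₂.IsHermitian) (hR₁ : Y₁ * Y₁ = R • Y₁) (hR₂ : Y₂ * Y₂ = R • Y₂)
    (t : ℝ) :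
    t * reTrace ((Y₁ - Y₂) * (NormedSpace.exp (t • (S + Y₁)) - NormedSpace.exp (t • (S + Y₂))))
      ≤ t ^ 2 * R * reTrace ((Y₁ + Y₂)
        * (NormedSpace.exp (t • (S + Y₁)) + NormedSpace.exp (t • (S + Y₂)))) := by
  have h := mul_reTrace_sub_mul_exp_sub_exp_le (hS.add h₁) (hS.add h₂) t
  rw [add_sub_add_left_eq_sub] at h
  refine h.trans ?_
  have hP : ((Y₁ + Y₂) * (Y₁ + Y₂)).PosSemidef := by
    have := posSemidef_conjTranspose_mul_self (Y₁ + Y₂)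
    rwa [(h₁.add h₂).eq] at this
  have key : ∀ A : Matrix n n ℂ, A.IsHermitian →
      reTrace ((Y₁ - Y₂) ^ 2 * NormedSpace.exp A)
        ≤ 2 * R * reTrace ((Y₁ + Y₂) * NormedSpace.exp A) := by
    intro A hA
    have h0 := reTrace_mul_exp_nonneg hA hP
    have : (Y₁ - Y₂) ^ 2 * NormedSpace.exp A + (Y₁ + Y₂) * (Y₁ + Y₂) * NormedSpace.exp A
        = (2 * R) • ((Y₁ + Y₂) * NormedSpace.exp A) := by
      rw [← add_mul, ← smul_mul_assoc]
      congr 1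
      rw [smul_add, mul_smul, mul_smul, ← hR₁, ← hR₂, two_smul, two_smul]
      noncomm_ring
    have h1 := congrArg reTrace this
    rw [map_add, map_smul, smul_eq_mul] at h1
    linarith
  have k1 := key _ (isHermitian_real_smul (hS.add h₁) t)
  have k2 := key _ (isHermitian_real_smul (hS.add h₂) t)
  rw [mul_add, mul_add, map_add, map_add]
  nlinarith [sq_nonneg t, mul_le_mul_of_nonneg_left (add_le_add k1 k2) (sq_nonneg t)]

/-- Integrate the exchangeable-pair bound over two independent copies: in the cross terms the copy
outside the exponential averages to `M`, and both sides are twice the stated ones. -/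
lemma integral_reTrace_resample_le (hY : StronglyMeasurable Y) (hB : ∀ e, ‖Y e‖ ≤ B)
    (hH : ∀ e, (Y e).IsHermitian) (hR : ∀ e, Y e * Y e = R • Y e)
    {S : Matrix n n ℂ} (hS : S.IsHermitian) (t : ℝ) :
    t * ∫ e, reTrace ((Y e - ∫ y, Y y ∂μ) * NormedSpace.exp (t • (S + Y e))) ∂μ
      ≤ t ^ 2 * R * ∫ e, reTrace ((Y e + ∫ y, Y y ∂μ) * NormedSpace.exp (t • (S + Y e))) ∂μ := by
  set M := ∫ y, Y y ∂μ with hM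
  set g : Matrix n n ℂ → Matrix n n ℂ → ℝ :=
    fun A C => reTrace (A * NormedSpace.exp (t • (S + C))) with hg
  have hgc : Continuous (fun p : Matrix n n ℂ × Matrix n n ℂ => g p.1 p.2) := by
    have := continuous_matrix_exp (n := n)
    simp only [hg]
    fun_prop
  have hYi : Integrable Y μ :=
    Integrable.of_bound hY.aestronglyMeasurable B (Filter.Eventually.of_forall hB)
  have hint : ∀ {u v : E × E → E}, Measurable u → Measurable v →
      Integrable (fun p => g (Y (u p)) (Y (v p))) (μ.prod μ) := fun hu hv =>
    integrable_continuous_comp_prodMk_of_bounded hgc (hY.comp_measurable hu)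
      (hY.comp_measurable hv) (fun s => hB _) (fun s => hB _)
  have i1 : Integrable (fun e => g (Y e) (Y e)) μ :=
    integrable_continuous_comp_prodMk_of_bounded hgc hY hY hB hB
  have i2 : Integrable (fun e => g M (Y e)) μ :=
    integrable_continuous_comp_of_bounded (B := B) (hgc.comp (Continuous.prodMk_right M)) hY hB
  have a1 : ∫ p, g (Y p.1) (Y p.1) ∂(μ.prod μ) = ∫ e, g (Y e) (Y e) ∂μ := by
    rw [integral_prod _ (hint measurable_fst measurable_fst)]
    simp
  have a2 : ∫ p, g (Y p.2) (Y p.2) ∂(μ.prod μ) = ∫ e, g (Y e) (Y e) ∂μ := by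
    rw [integral_prod _ (hint measurable_snd measurable_snd)]
    simp
  have hgM : ∀ C, ∫ y, g (Y y) C ∂μ = g M C := fun C => by
    simp only [hg, hM]
    exact (reTrace.comp ((ContinuousLinearMap.mul ℝ (Matrix n n ℂ)).flip
      (NormedSpace.exp (t • (S + C))))).integral_comp_comm hYi
  have b1 : ∫ p, g (Y p.2) (Y p.1) ∂(μ.prod μ) = ∫ e, g M (Y e) ∂μ := by
    rw [integral_prod _ (hint measurable_snd measurable_fst)]
    simp [hgM]
  have b2 : ∫ p, g (Y p.1) (Y p.2) ∂(μ.prod μ) = ∫ e, g M (Y e) ∂μ := by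
    rw [integral_prod_symm _ (hint measurable_fst measurable_snd)]
    simp [hgM]
  have hl : ∫ e, reTrace ((Y e - M) * NormedSpace.exp (t • (S + Y e))) ∂μ
      = ∫ e, g (Y e) (Y e) ∂μ - ∫ e, g M (Y e) ∂μ := by
    rw [← integral_sub i1 i2]
    simp only [hg, sub_mul, map_sub]
  have hr : ∫ e, reTrace ((Y e + M) * NormedSpace.exp (t • (S + Y e))) ∂μ
      = ∫ e, g (Y e) (Y e) ∂μ + ∫ e, g M (Y e) ∂μ := by
    rw [← integral_add i1 i2]
    simp only [hg, add_mul, map_add]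
  have j11 := hint measurable_fst measurable_fst
  have j22 := hint measurable_snd measurable_snd
  have j12 := hint measurable_fst measurable_snd
  have j21 := hint measurable_snd measurable_fst
  have s1 : Integrable (fun p => g (Y p.1) (Y p.1) - g (Y p.2) (Y p.1)) (μ.prod μ) := j11.sub j21
  have s2 : Integrable (fun p => g (Y p.1) (Y p.1) - g (Y p.2) (Y p.1) - g (Y p.1) (Y p.2))
    (μ.prod μ) := s1.sub j12
  have s3 : Integrable (fun p => g (Y p.1) (Y p.1) + g (Y p.2) (Y p.1)) (μ.prod μ) := j11.add j21
  have s4 : Integrable (fun p => g (Y p.1) (Y p.1) + g (Y p.2) (Y p.1) + g (Y p.1) (Y p.2))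
    (μ.prod μ) := s3.add j12
  have hpt : ∫ p, t * (((g (Y p.1) (Y p.1) - g (Y p.2) (Y p.1)) - g (Y p.1) (Y p.2))
        + g (Y p.2) (Y p.2)) ∂(μ.prod μ)
      ≤ ∫ p, t ^ 2 * R * (((g (Y p.1) (Y p.1) + g (Y p.2) (Y p.1)) + g (Y p.1) (Y p.2))
        + g (Y p.2) (Y p.2)) ∂(μ.prod μ) := by
    refine integral_mono ((s2.add j22).const_mul _)
      ((s4.add j22).const_mul _) fun p => ?_
    have := exchangeable_pair_trace_bound hS (hH p.1) (hH p.2) (hR p.1) (hR p.2) t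
    simp only [hg]
    simp only [add_mul, sub_mul, mul_add, mul_sub, map_add, map_sub] at this ⊢
    linarith
  have c1 : ∫ p, ((g (Y p.1) (Y p.1) - g (Y p.2) (Y p.1)) - g (Y p.1) (Y p.2))
      + g (Y p.2) (Y p.2) ∂(μ.prod μ) = 2 * (∫ e, g (Y e) (Y e) ∂μ - ∫ e, g M (Y e) ∂μ) := by
    rw [integral_add s2 j22, integral_sub s1 j12,
      integral_sub j11 j21, a1, a2, b1, b2]
    ring
  have c2 : ∫ p, ((g (Y p.1) (Y p.1) + g (Y p.2) (Y p.1)) + g (Y p.1) (Y p.2))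
      + g (Y p.2) (Y p.2) ∂(μ.prod μ) = 2 * (∫ e, g (Y e) (Y e) ∂μ + ∫ e, g M (Y e) ∂μ) := by
    rw [integral_add s4 j22, integral_add s3 j12,
      integral_add j11 j21, a1, a2, b1, b2]
    ring
  rw [integral_const_mul, integral_const_mul, c1, c2] at hpt
  rw [hl, hr]
  linarith

end Concentration

/-! ### A differential inequality for the trace moment generating function. -/

section Concentration

open Matrix MeasureTheory
open scoped ComplexOrder

variable {n : Type*} [Fintype n] [DecidableEq n] {E : Type*} [MeasurableSpace E]
  {Y : E → Matrix n n ℂ} {B R : ℝ}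

lemma Matrix.isHermitian_integral {μ : Measure E} (hH : ∀ e, (Y e).IsHermitian) :
    (∫ y, Y y ∂μ).IsHermitian := by
  rw [IsHermitian, ← star_eq_conjTranspose]
  have := ((starL' ℝ : Matrix n n ℂ ≃L[ℝ] Matrix n n ℂ).integral_comp_comm (μ := μ) Y).symm
  simp only [starL'_apply] at this
  rw [this]
  exact integral_congr_ae (Filter.Eventually.of_forall fun e => (hH e))

/-- Since `S` is bounded, the derivative of the integrand is bounded on a compact set of pairs `(t,
S)`, which gives the domination. -/
lemma hasDerivAt_integral_reTrace_exp {Ω : Type*} [MeasurableSpace Ω] {P : Measure Ω}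
    [IsFiniteMeasure P] {S : Ω → Matrix n n ℂ} (hS : StronglyMeasurable S) (hB : ∀ s, ‖S s‖ ≤ B)
    (t : ℝ) :
    HasDerivAt (fun t : ℝ => ∫ s, reTrace (NormedSpace.exp (t • S s)) ∂P)
      (∫ s, reTrace (S s * NormedSpace.exp (t • S s)) ∂P) t := by
  have hexp := continuous_matrix_exp (n := n)
  have hc : Continuous (fun p : ℝ × Matrix n n ℂ =>
      reTrace (p.2 * NormedSpace.exp (p.1 • p.2))) := by fun_prop
  obtain ⟨C, hC⟩ := ((isCompact_closedBall t 1).prod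
    (isCompact_closedBall (0 : Matrix n n ℂ) B)).exists_bound_of_continuousOn hc.continuousOn
  have hm : ∀ t : ℝ, AEStronglyMeasurable (fun s => reTrace (NormedSpace.exp (t • S s))) P :=
    fun t => (Continuous.comp_stronglyMeasurable
      (g := fun A : Matrix n n ℂ => reTrace (NormedSpace.exp (t • A)))
      (by fun_prop) hS).aestronglyMeasurable
  refine (hasDerivAt_integral_of_dominated_loc_of_deriv_le (bound := fun _ => C)
    (F := fun t s => reTrace (NormedSpace.exp (t • S s)))
    (F' := fun t s => reTrace (S s * NormedSpace.exp (t • S s)))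
    (Metric.ball_mem_nhds t one_pos) (Filter.Eventually.of_forall hm) ?_ ?_ ?_
    (integrable_const C) ?_).2
  · exact integrable_continuous_comp_of_bounded
      (f := fun A : Matrix n n ℂ => reTrace (NormedSpace.exp (t • A))) (by fun_prop) hS hB
  · exact (Continuous.comp_stronglyMeasurable
      (g := fun A : Matrix n n ℂ => reTrace (A * NormedSpace.exp (t • A)))
      (by fun_prop) hS).aestronglyMeasurable
  · refine Filter.Eventually.of_forall fun s u hu => ?_
    exact hC (u, S s) ⟨Metric.ball_subset_closedBall hu, by simpa using hB s⟩
  · refine Filter.Eventually.of_forall fun s u _ => ?_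
    exact (reTrace (n := n)).hasFDerivAt.comp_hasDerivAt u (hasDerivAt_exp_smul_const' (S s) u)

variable {ι : Type*} [Fintype ι]

/-- The centered sum of the matrices `Y (w k)`. -/
noncomputable def centeredSum (μ : Measure E) (Y : E → Matrix n n ℂ) (w : ι → E) : Matrix n n ℂ :=
  ∑ k, (Y (w k) - ∫ y, Y y ∂μ)

variable {μ : Measure E}

lemma isHermitian_centeredSum (hH : ∀ e, (Y e).IsHermitian) (w : ι → E) :
    (centeredSum μ Y w).IsHermitian :=
  (isSelfAdjoint_sum _ fun k _ => ((hH (w k)).sub (isHermitian_integral hH)).isSelfAdjoint :)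

lemma stronglyMeasurable_centeredSum (hY : StronglyMeasurable Y) :
    StronglyMeasurable (centeredSum μ Y : (ι → E) → Matrix n n ℂ) := by
  unfold centeredSum
  exact Finset.stronglyMeasurable_fun_sum _ fun k _ =>
    (hY.comp_measurable (measurable_pi_apply k)).sub stronglyMeasurable_const

lemma norm_centeredSum_le (hB : ∀ e, ‖Y e‖ ≤ B) (w : ι → E) :
    ‖centeredSum μ Y w‖ ≤ Fintype.card ι * (B + ‖∫ y, Y y ∂μ‖) := by
  refine (norm_sum_le_of_le _ fun k _ => (norm_sub_le _ _).trans
    (add_le_add_left (hB (w k)) _)).trans (le_of_eq ?_)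
  simp [mul_add]

variable [IsProbabilityMeasure μ]

lemma integral_reTrace_coordinate_le [DecidableEq ι] (hY : StronglyMeasurable Y)
    (hB : ∀ e, ‖Y e‖ ≤ B) (hH : ∀ e, (Y e).IsHermitian) (hR : ∀ e, Y e * Y e = R • Y e)
    (t : ℝ) (k : ι) :
    t * ∫ w, reTrace ((Y (w k) - ∫ y, Y y ∂μ) * NormedSpace.exp (t • centeredSum μ Y w))
        ∂(Measure.pi fun _ : ι => μ)
      ≤ t ^ 2 * R *
        ∫ w, reTrace ((Y (w k) + ∫ y, Y y ∂μ) * NormedSpace.exp (t • centeredSum μ Y w))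
          ∂(Measure.pi fun _ : ι => μ) := by
  set M := ∫ y, Y y ∂μ with hM
  have hexp := continuous_matrix_exp (n := n)
  set F : Matrix n n ℂ → Matrix n n ℂ → ℝ := fun A S => t * reTrace ((A - M) *
    NormedSpace.exp (t • S)) - t ^ 2 * R * reTrace ((A + M) * NormedSpace.exp (t • S)) with hF
  have hYk : StronglyMeasurable (fun w : ι → E => Y (w k)) :=
    hY.comp_measurable (measurable_pi_apply k)
  have hS := stronglyMeasurable_centeredSum (μ := μ) (ι := ι) hY
  have hSB := norm_centeredSum_le (μ := μ) (ι := ι) hB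
  have i1 : Integrable (fun w : ι → E => reTrace ((Y (w k) - M)
      * NormedSpace.exp (t • centeredSum μ Y w))) (Measure.pi fun _ => μ) :=
    integrable_continuous_comp_prodMk_of_bounded
      (f := fun A S => reTrace ((A - M) * NormedSpace.exp (t • S))) (by fun_prop) hYk hS
      (fun w => hB _) hSB
  have i2 : Integrable (fun w : ι → E => reTrace ((Y (w k) + M)
      * NormedSpace.exp (t • centeredSum μ Y w))) (Measure.pi fun _ => μ) :=
    integrable_continuous_comp_prodMk_of_bounded
      (f := fun A S => reTrace ((A + M) * NormedSpace.exp (t • S))) (by fun_prop) hYk hS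
      (fun w => hB _) hSB
  rw [← sub_nonpos, ← integral_const_mul, ← integral_const_mul,
    ← integral_sub (i1.const_mul _) (i2.const_mul _)]
  have i3 : Integrable (fun w : ι → E => F (Y (w k)) (centeredSum μ Y w))
    (Measure.pi fun _ => μ) := (i1.const_mul _).sub (i2.const_mul _)
  change ∫ w, F (Y (w k)) (centeredSum μ Y w) ∂(Measure.pi fun _ => μ) ≤ 0
  have hmp := measurePreserving_update_prod (ι := ι) μ k
  have i4 : Integrable (fun p : (ι → E) × E => F (Y (Function.update p.1 k p.2 k))
      (centeredSum μ Y (Function.update p.1 k p.2))) ((Measure.pi fun _ => μ).prod μ) :=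
    hmp.integrable_comp_of_integrable i3
  rw [← hmp.map_eq, integral_map hmp.measurable.aemeasurable
    (by rw [hmp.map_eq]; exact i3.aestronglyMeasurable), integral_prod _ i4]
  refine integral_nonpos fun w => ?_
  -- `S₀` also absorbs the `-M` of the resampled summand, so that the full sum is `S₀ + Y e`.
  set S₀ := ∑ j ∈ Finset.univ.erase k, (Y (w j) - M) - M with hS₀
  have hS₀H : S₀.IsHermitian :=
    (isSelfAdjoint_sum _ fun j _ => ((hH (w j)).sub (isHermitian_integral hH)).isSelfAdjoint :
      IsSelfAdjoint (∑ j ∈ Finset.univ.erase k, (Y (w j) - M))).sub (isHermitian_integral hH)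
  have hsum : ∀ e, centeredSum μ Y (Function.update w k e) = S₀ + Y e := fun e => by
    rw [centeredSum, ← Finset.add_sum_erase _ _ (Finset.mem_univ k), Function.update_self, hS₀]
    rw [Finset.sum_congr rfl fun j hj => by
      rw [Function.update_of_ne (Finset.ne_of_mem_erase hj)]]
    rw [← hM]
    abel
  simp only [Function.update_self, hsum, Pi.zero_apply]
  have j1 : Integrable (fun e => reTrace ((Y e - M) * NormedSpace.exp (t • (S₀ + Y e)))) μ :=
    integrable_continuous_comp_of_bounded
      (f := fun A => reTrace ((A - M) * NormedSpace.exp (t • (S₀ + A)))) (by fun_prop) hY hB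
  have j2 : Integrable (fun e => reTrace ((Y e + M) * NormedSpace.exp (t • (S₀ + Y e)))) μ :=
    integrable_continuous_comp_of_bounded
      (f := fun A => reTrace ((A + M) * NormedSpace.exp (t • (S₀ + A)))) (by fun_prop) hY hB
  simp only [hF]
  rw [integral_sub (j1.const_mul _) (j2.const_mul _), integral_const_mul, integral_const_mul,
    sub_nonpos]
  exact integral_reTrace_resample_le hY hB hH hR hS₀H t

/-- Sum the coordinate bounds. Writing `Y + M = (Y - M) + 2 M` with `M ≤ c` makes the right side
depend only on the moment generating function and its derivative. -/
lemma mul_integral_reTrace_centeredSum_mul_exp_le (hY : StronglyMeasurable Y)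
    (hB : ∀ e, ‖Y e‖ ≤ B) (hH : ∀ e, (Y e).IsHermitian) (hR : ∀ e, Y e * Y e = R • Y e)
    (hR0 : 0 ≤ R) {c : ℝ} (hM : (c • (1 : Matrix n n ℂ) - ∫ y, Y y ∂μ).PosSemidef) (t : ℝ) :
    t * ∫ w, reTrace (centeredSum μ Y w * NormedSpace.exp (t • centeredSum μ Y w))
        ∂(Measure.pi fun _ : ι => μ)
      ≤ t ^ 2 * R *
        (∫ w, reTrace (centeredSum μ Y w * NormedSpace.exp (t • centeredSum μ Y w))
          ∂(Measure.pi fun _ : ι => μ) + 2 * c * Fintype.card ι *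
          ∫ w, reTrace (NormedSpace.exp (t • centeredSum μ Y w))
            ∂(Measure.pi fun _ : ι => μ)) := by
  classical
  have hexp := continuous_matrix_exp (n := n)
  set M := ∫ y, Y y ∂μ with hMdef
  have hYk : ∀ k, StronglyMeasurable (fun w : ι → E => Y (w k)) := fun k =>
    hY.comp_measurable (measurable_pi_apply k)
  have hS := stronglyMeasurable_centeredSum (μ := μ) (ι := ι) hY
  have hSB := norm_centeredSum_le (μ := μ) (ι := ι) hB
  have i0 : Integrable (fun w : ι → E => reTrace (NormedSpace.exp (t • centeredSum μ Y w)))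
      (Measure.pi fun _ => μ) :=
    integrable_continuous_comp_of_bounded (f := fun A => reTrace (NormedSpace.exp (t • A)))
      (by fun_prop) hS hSB
  have i1 : ∀ k, Integrable (fun w : ι → E => reTrace ((Y (w k) - M)
      * NormedSpace.exp (t • centeredSum μ Y w))) (Measure.pi fun _ => μ) := fun k =>
    integrable_continuous_comp_prodMk_of_bounded
      (f := fun A S => reTrace ((A - M) * NormedSpace.exp (t • S))) (by fun_prop) (hYk k) hS
      (fun w => hB _) hSB
  have i2 : ∀ k, Integrable (fun w : ι → E => reTrace ((Y (w k) + M)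
      * NormedSpace.exp (t • centeredSum μ Y w))) (Measure.pi fun _ => μ) := fun k =>
    integrable_continuous_comp_prodMk_of_bounded
      (f := fun A S => reTrace ((A + M) * NormedSpace.exp (t • S))) (by fun_prop) (hYk k) hS
      (fun w => hB _) hSB
  have e1 : ∫ w, reTrace (centeredSum μ Y w * NormedSpace.exp (t • centeredSum μ Y w))
        ∂(Measure.pi fun _ : ι => μ) = ∑ k, ∫ w, reTrace ((Y (w k) - M)
      * NormedSpace.exp (t • centeredSum μ Y w)) ∂(Measure.pi fun _ : ι => μ) := by
    rw [← integral_finsetSum _ fun k _ => i1 k]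
    refine integral_congr_ae (Filter.Eventually.of_forall fun w => ?_)
    dsimp only
    rw [← map_sum, ← Finset.sum_mul]
    rfl
  have e2 : ∀ k, ∫ w, reTrace ((Y (w k) + M)
      * NormedSpace.exp (t • centeredSum μ Y w)) ∂(Measure.pi fun _ : ι => μ)
      ≤ ∫ w, reTrace ((Y (w k) - M)
      * NormedSpace.exp (t • centeredSum μ Y w)) ∂(Measure.pi fun _ : ι => μ)
      + 2 * c * ∫ w, reTrace (NormedSpace.exp (t • centeredSum μ Y w))
            ∂(Measure.pi fun _ : ι => μ) := by
    intro k
    rw [← integral_const_mul, ← integral_add (i1 k) (i0.const_mul _)]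
    refine integral_mono (i2 k) ((i1 k).add (i0.const_mul _)) fun w => ?_
    have := reTrace_mul_exp_nonneg
      (isHermitian_real_smul (isHermitian_centeredSum (μ := μ) hH w) t) hM
    simp only [sub_mul, add_mul, map_add, map_sub, smul_mul_assoc, one_mul, map_smul,
      smul_eq_mul] at this ⊢
    linarith
  have e3 := Finset.sum_le_sum fun k (_ : k ∈ (Finset.univ : Finset ι)) =>
    (integral_reTrace_coordinate_le hY hB hH hR t k).trans
      (mul_le_mul_of_nonneg_left (e2 k) (mul_nonneg (sq_nonneg t) hR0))
  rw [← Finset.mul_sum, ← Finset.mul_sum, Finset.sum_add_distrib, ← e1] at e3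
  refine e3.trans (le_of_eq ?_)
  rw [Finset.sum_const, Finset.card_univ, nsmul_eq_mul]
  ring

end Concentration

/-! ### Subgaussian bound and tail estimate. -/

section Concentration

open Matrix MeasureTheory
open scoped ComplexOrder

variable {n : Type*} [Fintype n] [DecidableEq n] {E : Type*} [MeasurableSpace E]
  {Y : E → Matrix n n ℂ} {B R : ℝ} {ι : Type*} [Fintype ι] {μ : Measure E} [IsProbabilityMeasure μ]

/-- A Grönwall argument along the segment from 0 to `t`; parametrizing it by `s ∈ [0, 1]` treats
both signs of `t` at once. -/
lemma le_mul_exp_of_mul_deriv_le {f f' : ℝ → ℝ} {K t : ℝ} (hf : ∀ u, HasDerivAt f (f' u) u)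
    (h : ∀ u, |u| ≤ |t| → u * f' u ≤ 2 * K * u ^ 2 * f u) :
    f t ≤ f 0 * Real.exp (K * t ^ 2) := by
  set g : ℝ → ℝ := fun s => f (s * t) * Real.exp (-(K * (s * t) ^ 2)) with hg
  have hd : ∀ s, HasDerivAt g (f' (s * t) * t * Real.exp (-(K * (s * t) ^ 2)) +
      f (s * t) * (Real.exp (-(K * (s * t) ^ 2)) * (-(K * (2 * (s * t) * t))))) s := by
    intro s
    have h1 : HasDerivAt (fun s : ℝ => s * t) t s := by
      simpa using (hasDerivAt_id s).mul_const t
    have h2 : HasDerivAt (fun s : ℝ => -(K * (s * t) ^ 2)) (-(K * (2 * (s * t) * t))) s := by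
      simpa using! ((h1.pow 2).const_mul K).neg
    exact ((hf (s * t)).comp s h1).mul h2.exp
  have hanti : AntitoneOn g (Set.Icc 0 1) := by
    refine antitoneOn_of_deriv_nonpos (convex_Icc 0 1)
      (fun s _ => (hd s).continuousAt.continuousWithinAt)
      (fun s _ => (hd s).differentiableAt.differentiableWithinAt) fun s hs => ?_
    rw [interior_Icc] at hs
    rw [(hd s).deriv]
    have h1 := h (s * t) (by
      rw [abs_mul, abs_of_pos hs.1]
      exact mul_le_of_le_one_left (abs_nonneg t) hs.2.le)
    have h2 : f' (s * t) * t - f (s * t) * (K * (2 * (s * t) * t)) ≤ 0 := by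
      refine nonpos_of_mul_nonpos_right ?_ hs.1
      linarith
    have h3 := mul_nonpos_of_nonpos_of_nonneg h2 (Real.exp_pos (-(K * (s * t) ^ 2))).le
    linarith
  have := hanti (Set.left_mem_Icc.2 zero_le_one) (Set.right_mem_Icc.2 zero_le_one) zero_le_one
  simp only [hg, one_mul, zero_mul] at this
  rw [Real.exp_neg, ← div_eq_mul_inv, div_le_iff₀ (Real.exp_pos _)] at this
  simpa using this

lemma integral_reTrace_exp_centeredSum_le (hY : StronglyMeasurable Y)
    (hB : ∀ e, ‖Y e‖ ≤ B) (hH : ∀ e, (Y e).IsHermitian) (hR : ∀ e, Y e * Y e = R • Y e)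
    (hR0 : 0 ≤ R) {c : ℝ} (hc : 0 ≤ c) (hM : (c • (1 : Matrix n n ℂ) - ∫ y, Y y ∂μ).PosSemidef)
    {t : ℝ} (ht : |t| * R ≤ 1 / 2) :
    ∫ w, reTrace (NormedSpace.exp (t • centeredSum μ Y w)) ∂(Measure.pi fun _ : ι => μ)
      ≤ Fintype.card n * Real.exp (2 * c * Fintype.card ι * R * t ^ 2) := by
  have hS := stronglyMeasurable_centeredSum (μ := μ) (ι := ι) hY
  have hSB := norm_centeredSum_le (μ := μ) (ι := ι) hB
  have := le_mul_exp_of_mul_deriv_le (K := 2 * c * Fintype.card ι * R) (t := t)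
    (fun u => hasDerivAt_integral_reTrace_exp (P := Measure.pi fun _ : ι => μ) hS hSB u) ?_
  · refine this.trans (le_of_eq ?_)
    simp [reTrace_apply]
  · intro u hu
    have h := mul_integral_reTrace_centeredSum_mul_exp_le (ι := ι) hY hB hH hR hR0 hM u
    set a := ∫ w, reTrace (centeredSum μ Y w * NormedSpace.exp (u • centeredSum μ Y w))
          ∂(Measure.pi fun _ : ι => μ)
    set b := ∫ w, reTrace (NormedSpace.exp (u • centeredSum μ Y w)) ∂(Measure.pi fun _ : ι => μ)
      with hb
    have hb0 : 0 ≤ b := integral_nonneg fun w => by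
      have := reTrace_mul_exp_nonneg
        (isHermitian_real_smul (isHermitian_centeredSum (μ := μ) hH w) u) PosSemidef.one
      simpa using this
    have hu' : u * R ≤ 1 / 2 :=
      (mul_le_mul_of_nonneg_right ((le_abs_self u).trans hu) hR0).trans ht
    have hpos : 0 ≤ 2 * c * Fintype.card ι * R * u ^ 2 * b := by positivity
    -- If `u * a > 0`, then `u² R a ≤ u a / 2` is absorbed on the left, which doubles the other
    -- term.
    by_cases ha : u * a ≤ 0
    · linarith
    · nlinarith

lemma measureReal_le_norm_centeredSum [Nonempty n] (hY : StronglyMeasurable Y)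
    (hB : ∀ e, ‖Y e‖ ≤ B) (hH : ∀ e, (Y e).IsHermitian) (hR : ∀ e, Y e * Y e = R • Y e)
    (hR0 : 0 ≤ R) {c : ℝ} (hc : 0 ≤ c) (hM : (c • (1 : Matrix n n ℂ) - ∫ y, Y y ∂μ).PosSemidef)
    {t : ℝ} (ht0 : 0 ≤ t) (ht : t * R ≤ 1 / 2) (a : ℝ) :
    (Measure.pi fun _ : ι => μ).real {w | a ≤ ‖centeredSum μ Y w‖}
      ≤ 2 * Fintype.card n * Real.exp (2 * c * Fintype.card ι * R * t ^ 2 - t * a) := by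
  have hexp := continuous_matrix_exp (n := n)
  have hS := stronglyMeasurable_centeredSum (μ := μ) (ι := ι) hY
  have hSB := norm_centeredSum_le (μ := μ) (ι := ι) hB
  have i0 : ∀ t : ℝ, Integrable (fun w : ι → E =>
      reTrace (NormedSpace.exp (t • centeredSum μ Y w))) (Measure.pi fun _ => μ) := fun t =>
    integrable_continuous_comp_of_bounded (f := fun A => reTrace (NormedSpace.exp (t • A)))
      (by fun_prop) hS hSB
  have h1 := integral_reTrace_exp_centeredSum_le (ι := ι) hY hB hH hR hR0 hc hM (t := t)
    (by rwa [abs_of_nonneg ht0])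
  have h2 := integral_reTrace_exp_centeredSum_le (ι := ι) hY hB hH hR hR0 hc hM (t := -t)
    (by rwa [abs_neg, abs_of_nonneg ht0])
  rw [neg_sq] at h2
  have hle : ∀ w : ι → E, Real.exp (t * ‖centeredSum μ Y w‖) ≤
      reTrace (NormedSpace.exp (t • centeredSum μ Y w))
        + reTrace (NormedSpace.exp ((-t) • centeredSum μ Y w)) := fun w => by
    have := exp_norm_le_reTrace_exp_add
      (isHermitian_real_smul (isHermitian_centeredSum (μ := μ) hH w) t)
    rwa [norm_smul, Real.norm_of_nonneg ht0, ← neg_smul] at this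
  have hmark := mul_meas_ge_le_integral_of_nonneg (μ := Measure.pi fun _ : ι => μ)
    (f := fun w => reTrace (NormedSpace.exp (t • centeredSum μ Y w))
        + reTrace (NormedSpace.exp ((-t) • centeredSum μ Y w)))
    (Filter.Eventually.of_forall fun w => (Real.exp_pos _).le.trans (hle w))
    ((i0 t).add (i0 (-t))) (Real.exp (t * a))
  rw [integral_add (i0 t) (i0 (-t))] at hmark
  have hsub : (Measure.pi fun _ : ι => μ).real {w | a ≤ ‖centeredSum μ Y w‖} ≤
      (Measure.pi fun _ : ι => μ).real {w | Real.exp (t * a) ≤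
        reTrace (NormedSpace.exp (t • centeredSum μ Y w))
        + reTrace (NormedSpace.exp ((-t) • centeredSum μ Y w))} :=
    measureReal_mono fun w hw => (Real.exp_le_exp.2 (mul_le_mul_of_nonneg_left hw ht0)).trans (hle w)
  refine hsub.trans ?_
  rw [Real.exp_sub, ← mul_div_assoc, le_div_iff₀ (Real.exp_pos _), mul_comm]
  linarith

end Concentration

/-! ### The characteristic function of the Student distribution. -/

section CharacteristicFunction

open MeasureTheory Set

lemma integrableOn_rpow_mul_exp_neg_add_div {α b : ℝ} (hα : 0 < α) (hb : 0 ≤ b) :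
    IntegrableOn (fun s : ℝ => s ^ (α - 1) * Real.exp (-(s + b / s))) (Ioi 0) := by
  refine (Real.GammaIntegral_convergent hα).mono' ?_ ?_
  · exact Measurable.aestronglyMeasurable (by fun_prop)
  · filter_upwards [ae_restrict_mem measurableSet_Ioi] with s hs
    have hs' : (0 : ℝ) < s := hs
    rw [Real.norm_of_nonneg (by positivity), mul_comm]
    gcongr
    have : 0 ≤ b / s := by positivity
    linarith

/-- Substituting `s = (z / 2) exp t` turns `s + z² / (4 s)` into `z cosh t`; folding the line at 0
produces `cosh (α t)`. -/
lemma integral_rpow_mul_exp_neg_add_div {α z : ℝ} (hα : 0 < α) (hz : 0 < z) :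
    ∫ s in Ioi (0 : ℝ), s ^ (α - 1) * Real.exp (-(s + z ^ 2 / 4 / s))
      = 2 * (z / 2) ^ α * besselK α z := by
  set f : ℝ → ℝ := fun t => z / 2 * Real.exp t with hf
  set g : ℝ → ℝ := fun s => s ^ (α - 1) * Real.exp (-(s + z ^ 2 / 4 / s)) with hg
  have himg : f '' univ = Ioi 0 := by
    ext s
    simp only [hf, image_univ, mem_range, mem_Ioi]
    constructor
    · rintro ⟨t, rfl⟩; positivity
    · intro hs
      refine ⟨Real.log (s / (z / 2)), ?_⟩
      rw [Real.exp_log (by positivity)]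
      field_simp
  have hder : ∀ t ∈ (univ : Set ℝ), HasDerivWithinAt f (z / 2 * Real.exp t) univ t := fun t _ =>
    ((Real.hasDerivAt_exp t).const_mul _).hasDerivWithinAt
  have hinj : InjOn f univ := fun s _ t _ h => by
    have := mul_left_cancel₀ (by positivity) h
    exact Real.exp_injective this
  have hpt : ∀ t : ℝ, |z / 2 * Real.exp t| • g (f t)
      = (z / 2) ^ α * (Real.exp (α * t) * Real.exp (-z * Real.cosh t)) := by
    intro t
    have hp : 0 < z / 2 * Real.exp t := by positivity
    have e1 : (z / 2 * Real.exp t) * (z / 2 * Real.exp t) ^ (α - 1)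
        = (z / 2) ^ α * Real.exp (α * t) := by
      rw [Real.rpow_sub_one hp.ne', mul_div_cancel₀ _ hp.ne', Real.mul_rpow (by positivity)
        (Real.exp_pos t).le, ← Real.exp_mul, mul_comm t]
    have e2 : z / 2 * Real.exp t + z ^ 2 / 4 / (z / 2 * Real.exp t) = z * Real.cosh t := by
      rw [Real.cosh_eq, Real.exp_neg]
      field_simp
      ring
    simp only [hg, hf]
    rw [e2, abs_of_pos hp, smul_eq_mul, ← mul_assoc, e1, neg_mul]
    ring
  have hint : IntegrableOn g (f '' univ) := by
    rw [himg]; exact integrableOn_rpow_mul_exp_neg_add_div hα (by positivity)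
  rw [integrableOn_image_iff_integrableOn_abs_deriv_smul MeasurableSet.univ hder hinj] at hint
  change ∫ s in Ioi (0 : ℝ), g s = _
  rw [← himg, integral_image_eq_integral_abs_deriv_smul MeasurableSet.univ hder hinj]
  simp only [hpt, integrableOn_univ, Measure.restrict_univ] at hint ⊢
  rw [integral_const_mul]
  have hint' : Integrable (fun t : ℝ => Real.exp (α * t) * Real.exp (-z * Real.cosh t)) := by
    have := hint.const_mul ((z / 2) ^ α)⁻¹
    have h0 : (z / 2) ^ α ≠ 0 := by positivity
    simpa [← mul_assoc, inv_mul_cancel₀ h0] using this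
  rw [← intervalIntegral.integral_Iic_add_Ioi (b := 0) hint'.integrableOn hint'.integrableOn]
  have hneg : ∫ t in Iic (0 : ℝ), Real.exp (α * t) * Real.exp (-z * Real.cosh t)
      = ∫ t in Ioi (0 : ℝ), Real.exp (-(α * t)) * Real.exp (-z * Real.cosh t) := by
    have := integral_comp_neg_Ioi (0 : ℝ)
      (fun t : ℝ => Real.exp (α * t) * Real.exp (-z * Real.cosh t))
    rw [neg_zero] at this
    rw [← this]
    simp
  have hint'' : IntegrableOn (fun t : ℝ => Real.exp (-(α * t)) * Real.exp (-z * Real.cosh t))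
      (Ioi 0) := by
    have := hint'.comp_neg
    simpa using this.integrableOn
  rw [hneg, ← integral_add hint'' hint'.integrableOn, besselK, mul_assoc, mul_comm (2 : ℝ),
    mul_assoc, ← integral_mul_const]
  congr 1
  refine integral_congr_ae (Filter.Eventually.of_forall fun t => ?_)
  simp only [Real.cosh_eq (α * t)]
  ring

/-- In this form the integrand is nonnegative and decreasing in `r`, properties the profile
inherits. -/
lemma maternProfile_eq_integral {σ ν r : ℝ} (hσ : 0 < σ) (hν : 0 < ν) (hr : 0 < r) :
    maternProfile σ ν r = (Real.Gamma (ν / 2))⁻¹ *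
      ∫ s in Ioi (0 : ℝ), s ^ (ν / 2 - 1) * Real.exp (-(s + (σ * √ν * r) ^ 2 / 4 / s)) := by
  have hz : 0 < σ * √ν * r := by positivity
  rw [integral_rpow_mul_exp_neg_add_div (by positivity) hz, maternProfile,
    Real.div_rpow hz.le zero_le_two, Real.rpow_sub_one two_ne_zero]
  have := (Real.Gamma_pos_of_pos (half_pos hν)).ne'
  field_simp

lemma maternProfile_nonneg {σ ν r : ℝ} (hσ : 0 < σ) (hν : 0 < ν) (hr : 0 < r) :
    0 ≤ maternProfile σ ν r := by
  rw [maternProfile_eq_integral hσ hν hr]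
  refine mul_nonneg (inv_nonneg.2 (Real.Gamma_pos_of_pos (half_pos hν)).le) ?_
  refine setIntegral_nonneg measurableSet_Ioi fun s hs => ?_
  have hs' : (0 : ℝ) < s := hs
  positivity

lemma maternProfile_antitoneOn {σ ν : ℝ} (hσ : 0 < σ) (hν : 0 < ν) :
    AntitoneOn (maternProfile σ ν) (Ioi 0) := by
  intro r hr r' hr' h
  have h0 : (0 : ℝ) < r := hr
  rw [maternProfile_eq_integral hσ hν hr, maternProfile_eq_integral hσ hν hr']
  refine mul_le_mul_of_nonneg_left ?_ (inv_nonneg.2 (Real.Gamma_pos_of_pos (half_pos hν)).le)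
  refine setIntegral_mono_on
    (integrableOn_rpow_mul_exp_neg_add_div (half_pos hν) (by positivity))
    (integrableOn_rpow_mul_exp_neg_add_div (half_pos hν) (by positivity)) measurableSet_Ioi
    fun s hs => ?_
  have hs' : (0 : ℝ) < s := hs
  gcongr

variable {d : ℕ}

/-- Justifies Fubini for the mixture: integrating out the Gaussian modulus costs `s ^ (-d / 2)`,
leaving the convergent Gamma integral at `ν / 2`. -/
lemma integrable_gamma_gaussian {a ν : ℝ} (ha : 0 < a) (hν : 0 < ν)
    (y : EuclideanSpace ℝ (Fin d)) :
    Integrable (fun p : ℝ × EuclideanSpace ℝ (Fin d) =>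
      ((p.1 ^ ((ν + d) / 2 - 1) * Real.exp (-p.1) : ℝ) : ℂ)
        * Complex.exp (-((p.1 * a : ℝ) : ℂ) * (‖p.2‖ : ℂ) ^ 2 + Complex.I * (inner ℝ y p.2 : ℝ)))
      ((volume.restrict (Ioi (0 : ℝ))).prod volume) := by
  rw [integrable_prod_iff (by
    refine Measurable.aestronglyMeasurable ?_
    fun_prop)]
  constructor
  · filter_upwards [ae_restrict_mem measurableSet_Ioi] with s hs
    have hs' : (0 : ℝ) < s := hs
    refine Integrable.const_mul ?_ _
    exact GaussianFourier.integrable_cexp_neg_mul_sq_norm_add_of_euclideanSpace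
      (by rw [Complex.ofReal_re]; positivity) Complex.I y
  · refine ((Real.GammaIntegral_convergent (half_pos hν)).const_mul
      ((Real.pi / a) ^ ((d : ℝ) / 2))).congr ?_
    filter_upwards [ae_restrict_mem measurableSet_Ioi] with s hs
    have hs' : (0 : ℝ) < s := hs
    have hn : ∀ w : EuclideanSpace ℝ (Fin d),
        ‖((s ^ ((ν + d) / 2 - 1) * Real.exp (-s) : ℝ) : ℂ)
        * Complex.exp (-((s * a : ℝ) : ℂ) * (‖w‖ : ℂ) ^ 2 + Complex.I * (inner ℝ y w : ℝ))‖
        = s ^ ((ν + d) / 2 - 1) * Real.exp (-s) * Real.exp (-(s * a) * ‖w‖ ^ 2) := by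
      intro w
      rw [norm_mul, Complex.norm_real, Complex.norm_exp, Real.norm_of_nonneg (by positivity)]
      congr 2
      have : -((s * a : ℝ) : ℂ) * (‖w‖ : ℂ) ^ 2 = ((-(s * a) * ‖w‖ ^ 2 : ℝ) : ℂ) := by push_cast; ring
      rw [this, Complex.add_re, Complex.ofReal_re]
      simp
    simp only [hn]
    rw [integral_const_mul, GaussianFourier.integral_rexp_neg_mul_sq_norm (by positivity),
      finrank_euclideanSpace_fin, mul_comm s a, ← div_div, Real.div_rpow (by positivity) hs'.le,
      show (ν + d) / 2 - 1 = (ν / 2 - 1) + (d : ℝ) / 2 by ring, Real.rpow_add hs']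
    have : s ^ ((d : ℝ) / 2) ≠ 0 := by positivity
    field_simp

lemma integral_studentT_cexp {σ ν : ℝ} (hσ : 0 < σ) (hν : 0 < ν)
    {y : EuclideanSpace ℝ (Fin d)} (hy : y ≠ 0) :
    ∫ w, Complex.exp (Complex.I * (inner ℝ y w : ℝ)) ∂(studentT d σ ν)
      = (maternProfile σ ν ‖y‖ : ℂ) := by
  set a : ℝ := 1 / (σ ^ 2 * ν) with ha
  have ha0 : 0 < a := by positivity
  set β : ℝ := (ν + d) / 2 with hβ
  have hβ0 : 0 < β := by positivity
  have hΓβ := Real.Gamma_pos_of_pos hβ0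
  have hΓν := Real.Gamma_pos_of_pos (half_pos hν)
  set Z : ℝ := Real.Gamma β / (σ ^ d * Real.pi ^ ((d : ℝ) / 2) * ν ^ ((d : ℝ) / 2)
    * Real.Gamma (ν / 2)) with hZ
  have hZ0 : 0 < Z := by positivity
  have hdens : ∀ w, studentTDensity d σ ν w = Z * (1 + a * ‖w‖ ^ 2) ^ (-β) := fun w => rfl
  have hpos : ∀ w : EuclideanSpace ℝ (Fin d), 0 < 1 + a * ‖w‖ ^ 2 := fun w => by positivity
  have hmeas : Measurable (fun w => ENNReal.ofReal (studentTDensity d σ ν w)) := by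
    simp only [hdens]
    fun_prop
  rw [studentT, integral_withDensity_eq_integral_toReal_smul hmeas
    (Filter.Eventually.of_forall fun w => ENNReal.ofReal_lt_top)]
  -- The Gamma integral exhibits the density as a mixture over `s` of Gaussians `exp (-s a ‖w‖²)`.
  have hmix : ∀ w, studentTDensity d σ ν w = Z / Real.Gamma β *
      ∫ s in Ioi (0 : ℝ), s ^ (β - 1) * Real.exp (-((1 + a * ‖w‖ ^ 2) * s)) := fun w => by
    rw [Real.integral_rpow_mul_exp_neg_mul_Ioi hβ0 (hpos w), hdens, one_div,
      Real.inv_rpow (hpos w).le, Real.rpow_neg (hpos w).le]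
    field_simp
  have hdn : ∀ w, (ENNReal.ofReal (studentTDensity d σ ν w)).toReal = studentTDensity d σ ν w :=
    fun w => ENNReal.toReal_ofReal (by rw [hdens]; have := hpos w; positivity)
  have hF := integrable_gamma_gaussian ha0 hν y
  have hdensity_mul : ∀ w, (ENNReal.ofReal (studentTDensity d σ ν w)).toReal
        • Complex.exp (Complex.I * (inner ℝ y w : ℝ))
      = ((Z / Real.Gamma β : ℝ) : ℂ) * ∫ s in Ioi (0 : ℝ),
        ((s ^ (β - 1) * Real.exp (-s) : ℝ) : ℂ)
        * Complex.exp (-((s * a : ℝ) : ℂ) * (‖w‖ : ℂ) ^ 2 + Complex.I * (inner ℝ y w : ℝ)) := by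
    intro w
    rw [hdn, hmix, Complex.real_smul, Complex.ofReal_mul, mul_assoc, ← integral_complex_ofReal,
      ← integral_mul_const]
    congr 1
    refine integral_congr_ae (Filter.Eventually.of_forall fun s => ?_)
    simp only [Complex.ofReal_mul, Complex.ofReal_exp, mul_assoc, ← Complex.exp_add]
    congr 2
    push_cast
    ring
  simp only [hdensity_mul]
  rw [integral_const_mul, ← integral_integral_swap
    (f := fun s w => ((s ^ (β - 1) * Real.exp (-s) : ℝ) : ℂ)
        * Complex.exp (-((s * a : ℝ) : ℂ) * (‖w‖ : ℂ) ^ 2 + Complex.I * (inner ℝ y w : ℝ))) hF]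
  have hy0 : 0 < ‖y‖ := norm_pos_iff.2 hy
  have hgaussian : ∀ s ∈ Ioi (0 : ℝ), ∫ w : EuclideanSpace ℝ (Fin d),
      ((s ^ (β - 1) * Real.exp (-s) : ℝ) : ℂ)
        * Complex.exp (-((s * a : ℝ) : ℂ) * (‖w‖ : ℂ) ^ 2 + Complex.I * (inner ℝ y w : ℝ))
      = (((Real.pi / a) ^ ((d : ℝ) / 2) *
        (s ^ (ν / 2 - 1) * Real.exp (-(s + (σ * √ν * ‖y‖) ^ 2 / 4 / s))) : ℝ) : ℂ) := by
    intro s hs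
    have hs' : (0 : ℝ) < s := hs
    rw [integral_const_mul, GaussianFourier.integral_cexp_neg_mul_sq_norm_add_of_euclideanSpace
      (by rw [Complex.ofReal_re]; positivity), Fintype.card_fin]
    have e1 : ((Real.pi : ℂ) / ((s * a : ℝ) : ℂ)) ^ ((d : ℂ) / 2)
        = (((Real.pi / (s * a)) ^ ((d : ℝ) / 2) : ℝ) : ℂ) := by
      rw [Complex.ofReal_cpow (by positivity)]
      push_cast
      rfl
    have e2 : Complex.exp (Complex.I ^ 2 * (‖y‖ : ℂ) ^ 2 / (4 * ((s * a : ℝ) : ℂ)))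
        = ((Real.exp (-((σ * √ν * ‖y‖) ^ 2 / 4 / s)) : ℝ) : ℂ) := by
      rw [Complex.ofReal_exp]
      congr 1
      have : (-((σ * √ν * ‖y‖) ^ 2 / 4 / s)) = -(‖y‖ ^ 2 / (4 * (s * a))) := by
        rw [mul_pow, mul_pow, Real.sq_sqrt hν.le, ha]
        field_simp
      rw [this, Complex.I_sq]
      push_cast
      ring
    rw [e1, e2, ← Complex.ofReal_mul, ← Complex.ofReal_mul]
    congr 1
    rw [mul_comm s a, ← div_div, Real.div_rpow (by positivity) hs'.le, neg_add, Real.exp_add,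
      show β - 1 = (ν / 2 - 1) + (d : ℝ) / 2 by rw [hβ]; ring, Real.rpow_add hs']
    have : s ^ ((d : ℝ) / 2) ≠ 0 := by positivity
    field_simp
  rw [setIntegral_congr_fun measurableSet_Ioi hgaussian, integral_complex_ofReal, ← Complex.ofReal_mul,
    integral_const_mul, maternProfile_eq_integral hσ hν hy0]
  congr 1
  rw [← mul_assoc]
  congr 1
  have e3 : (Real.pi / a) ^ ((d : ℝ) / 2)
      = Real.pi ^ ((d : ℝ) / 2) * (σ ^ d * ν ^ ((d : ℝ) / 2)) := by
    rw [ha, one_div, div_inv_eq_mul, Real.mul_rpow Real.pi_pos.le (by positivity),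
      Real.mul_rpow (by positivity) hν.le, ← Real.rpow_natCast σ 2, ← Real.rpow_mul hσ.le,
      ← Real.rpow_natCast σ d]
    congr 3
    push_cast
    ring
  rw [e3, hZ]
  field_simp

end CharacteristicFunction

/-! ### Algebra and mean of the rank-one summands. -/

section FeatureMatrix

open Matrix MeasureTheory

lemma Matrix.l2_opNorm_le_card_mul {n : Type*} [Fintype n] [DecidableEq n] {A : Matrix n n ℂ}
    {c : ℝ} (hc : 0 ≤ c) (hA : ∀ i j, ‖A i j‖ ≤ c) : ‖A‖ ≤ Fintype.card n * c := by
  rw [l2_opNorm_def]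
  refine ContinuousLinearMap.opNorm_le_bound _ (by positivity) fun v => ?_
  refine le_of_sq_le_sq ?_ (by positivity)
  rw [EuclideanSpace.norm_sq_eq]
  have hrow : ∀ i, ‖(A *ᵥ v.ofLp) i‖ ^ 2 ≤ Fintype.card n * c ^ 2 * ‖v‖ ^ 2 := by
    intro i
    have h1 : ‖(A *ᵥ v.ofLp) i‖ ≤ ∑ j, c * ‖v j‖ :=
      norm_sum_le_of_le _ fun j _ => by
        rw [norm_mul]; exact mul_le_mul_of_nonneg_right (hA i j) (norm_nonneg _)
    have h2 := sq_sum_le_card_mul_sum_sq (s := Finset.univ) (f := fun j => c * ‖v j‖)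
    calc _ ≤ (∑ j, c * ‖v j‖) ^ 2 := by gcongr
      _ ≤ _ := h2
      _ = _ := by
        rw [EuclideanSpace.norm_sq_eq, Finset.card_univ, mul_assoc]
        simp only [mul_pow, ← Finset.mul_sum]
  refine (Finset.sum_le_sum fun i _ => hrow i).trans (le_of_eq ?_)
  rw [Finset.sum_const, Finset.card_univ, nsmul_eq_mul]
  ring

-- A self-adjoint element is at most its norm, so `M - 1 ≤ 1`.
open scoped MatrixOrder ComplexOrder in
lemma Matrix.posSemidef_two_smul_one_sub {n : Type*} [Fintype n] [DecidableEq n]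
    {M : Matrix n n ℂ} (hM : M.IsHermitian) (h : ‖M - 1‖ ≤ 1) :
    ((2 : ℝ) • (1 : Matrix n n ℂ) - M).PosSemidef := by
  have h1 : IsSelfAdjoint (M - 1) := (hM.sub isHermitian_one).isSelfAdjoint
  have h2 := h1.le_algebraMap_norm_self
  have h3 : algebraMap ℝ (Matrix n n ℂ) ‖M - 1‖ ≤ algebraMap ℝ (Matrix n n ℂ) 1 :=
    algebraMap_mono _ h
  have h4 := h2.trans h3
  rw [map_one] at h4
  rw [← Matrix.le_iff]
  calc M = M - 1 + 1 := by abel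
    _ ≤ 1 + 1 := add_le_add_left h4 1
    _ = _ := by rw [two_smul]

variable {d m : ℕ}

/-- The rank-one matrix contributed by a single frequency to `A * Aᴴ`. -/
noncomputable def featureGram (x : Fin m → EuclideanSpace ℝ (Fin d))
    (w : EuclideanSpace ℝ (Fin d)) : Matrix (Fin m) (Fin m) ℂ :=
  Matrix.of fun i j => Complex.exp (Complex.I * ((inner ℝ (x i - x j) w : ℝ) : ℂ))

variable (x : Fin m → EuclideanSpace ℝ (Fin d))

lemma featureMatrix_mul_conjTranspose {N : ℕ} (w : Fin N → EuclideanSpace ℝ (Fin d)) :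
    featureMatrix x w * (featureMatrix x w)ᴴ = ∑ k, featureGram x (w k) := by
  ext i j
  rw [mul_apply, Matrix.sum_apply]
  refine Finset.sum_congr rfl fun k _ => ?_
  simp only [featureMatrix, featureGram, conjTranspose_apply, of_apply, Complex.star_def,
    ← Complex.exp_conj, map_mul, Complex.conj_I, Complex.conj_ofReal, ← Complex.exp_add]
  congr 1
  rw [inner_sub_left, real_inner_comm (w k), real_inner_comm (w k)]
  push_cast
  ring

lemma continuous_featureGram : Continuous (featureGram x) := by
  refine continuous_matrix fun i j => ?_
  simp only [featureGram, of_apply]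
  fun_prop

lemma isHermitian_featureGram (w : EuclideanSpace ℝ (Fin d)) : (featureGram x w).IsHermitian := by
  ext i j
  simp only [featureGram, conjTranspose_apply, of_apply, Complex.star_def,
    ← Complex.exp_conj, map_mul, Complex.conj_I, Complex.conj_ofReal]
  congr 1
  rw [← neg_sub (x i) (x j), inner_neg_left]
  push_cast
  ring

/-- The matrix is `v vᴴ` with `m` unimodular entries in `v`, so `‖v‖² = m`. -/
lemma featureGram_mul_self (w : EuclideanSpace ℝ (Fin d)) :
    featureGram x w * featureGram x w = (m : ℝ) • featureGram x w := by
  ext i j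
  rw [mul_apply]
  have : ∀ k, featureGram x w i k * featureGram x w k j = featureGram x w i j := fun k => by
    simp only [featureGram, of_apply, ← Complex.exp_add]
    rw [← sub_add_sub_cancel (x i) (x k) (x j), inner_add_left]
    congr 1
    push_cast
    ring
  simp [this]

lemma norm_featureGram_le (w : EuclideanSpace ℝ (Fin d)) : ‖featureGram x w‖ ≤ m := by
  have h1 : ‖featureGram x w‖ * ‖featureGram x w‖ = m * ‖featureGram x w‖ := by
    rw [← CStarRing.norm_star_mul_self, star_eq_conjTranspose, (isHermitian_featureGram x w).eq,
      featureGram_mul_self, norm_smul, Real.norm_of_nonneg (Nat.cast_nonneg m)]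
  by_cases h : ‖featureGram x w‖ = 0
  · rw [h]; exact Nat.cast_nonneg m
  · exact (mul_right_cancel₀ h h1).le

variable {σ ν : ℝ} [IsProbabilityMeasure (studentT d σ ν)]

lemma integral_featureGram_apply (hσ : 0 < σ) (hν : 0 < ν) (i j : Fin m) :
    (∫ w, featureGram x w ∂(studentT d σ ν)) i j
      = if x i = x j then 1 else (maternProfile σ ν ‖x i - x j‖ : ℂ) := by
  have hint : Integrable (featureGram x) (studentT d σ ν) :=
    Integrable.of_bound (continuous_featureGram x).stronglyMeasurable.aestronglyMeasurable m
      (Filter.Eventually.of_forall (norm_featureGram_le x))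
  have h1 := (LinearMap.toContinuousLinearMap
    (Matrix.entryLinearMap ℂ ℂ i j : Matrix (Fin m) (Fin m) ℂ →ₗ[ℂ] ℂ)).integral_comp_comm hint
  simp only [LinearMap.coe_toContinuousLinearMap', entryLinearMap_apply] at h1
  rw [← h1]
  simp only [featureGram, of_apply]
  split_ifs with h
  · simp [h]
  · exact integral_studentT_cexp hσ hν (sub_ne_zero.2 h)

lemma norm_integral_featureGram_sub_one_le (hσ : 0 < σ) (hν : 0 < ν) {κ η : ℝ} (hκ : 0 < κ)
    (hη : 0 ≤ η) (hsep : ∀ j j' : Fin m, j ≠ j' → κ ≤ ‖x j - x j'‖)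
    (hprof : maternProfile σ ν κ ≤ η / m) :
    ‖∫ w, featureGram x w ∂(studentT d σ ν) - 1‖ ≤ η := by
  rcases Nat.eq_zero_or_pos m with rfl | hm
  · rw [Subsingleton.elim (∫ w, featureGram x w ∂(studentT d σ ν) - 1) 0, norm_zero]
    exact hη
  have hm' : (0 : ℝ) < m := by exact_mod_cast hm
  refine (Matrix.l2_opNorm_le_card_mul (c := η / m) (by positivity) fun i j => ?_).trans
    (le_of_eq (by rw [Fintype.card_fin]; field_simp))
  rw [Matrix.sub_apply, integral_featureGram_apply x hσ hν]
  by_cases h : i = j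
  · subst h
    simp only [if_true, one_apply_eq, sub_self, norm_zero]
    positivity
  · have hk := hsep i j h
    have hk0 : 0 < ‖x i - x j‖ := hκ.trans_le hk
    rw [if_neg (sub_ne_zero.1 (norm_pos_iff.1 hk0)), one_apply_ne h, sub_zero, Complex.norm_real,
      Real.norm_of_nonneg (maternProfile_nonneg hσ hν hk0)]
    -- Distances are at least `κ`, so monotonicity reduces every off-diagonal entry to the
    -- hypothesis at `κ`.
    exact (maternProfile_antitoneOn hσ hν hκ hk0 hk).trans hprof

end FeatureMatrix

/-! ### The main theorem. -/

theorem theorem1 :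
    ∃ C : ℝ, 0 < C ∧
      ∀ (d m N : ℕ) (D : Set (EuclideanSpace ℝ (Fin d))) (x : Fin m → EuclideanSpace ℝ (Fin d))
        (κ σ ν δ η : ℝ)
        (Ω : Type*) [MeasurableSpace Ω] (P : MeasureTheory.Measure Ω)
        [MeasureTheory.IsProbabilityMeasure P]
        (ω : Fin N → Ω → EuclideanSpace ℝ (Fin d)),
        IsCompact D →
        (∀ j, x j ∈ D) →
        0 < κ →
        (∀ j j' : Fin m, j ≠ j' → κ ≤ ‖x j - x j'‖) →
        0 < σ → 0 < ν →
        0 < δ → δ < 1 →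
        0 < η → η < 1 →
        ProbabilityTheory.iIndepFun ω P →
        (∀ k, ProbabilityTheory.HasLaw (ω k) (studentT d σ ν) P) →
        C * η⁻¹ ^ 2 * (m : ℝ) * Real.log (2 * (m : ℝ) / δ) ≤ (N : ℝ) →
        maternProfile σ ν κ ≤ η / (m : ℝ) →
        ENNReal.ofReal (1 - δ) ≤
          P {s | ‖(1 / (N : ℂ)) • (featureMatrix x (fun k => ω k s)
                  * (featureMatrix x (fun k => ω k s)).conjTranspose)
                - (1 : Matrix (Fin m) (Fin m) ℂ)‖ ≤ 2 * η} := by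
  refine ⟨16, by norm_num, ?_⟩
  intro d m N D x κ σ ν δ η Ω _ P _ ω _ _ hκ hsep hσ hν hδ hδ1 hη hη1 hind hlaw hN hprof
  rcases Nat.eq_zero_or_pos m with rfl | hm
  · have : ∀ A : Matrix (Fin 0) (Fin 0) ℂ, ‖A‖ ≤ 2 * η := fun A => by
      rw [Subsingleton.elim A 0, norm_zero]; positivity
    simp only [this, Set.ofPred_true, MeasureTheory.measure_univ]
    exact ENNReal.ofReal_le_one.2 (by linarith)
  have : Nonempty (Fin m) := ⟨⟨0, hm⟩⟩
  have hm1 : (1 : ℝ) ≤ m := by exact_mod_cast hm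
  have hlog : 0 < Real.log (2 * m / δ) :=
    Real.log_pos (by rw [lt_div_iff₀ hδ]; linarith)
  have hN0 : (0 : ℝ) < N := lt_of_lt_of_le (by positivity) hN
  have hNpos : 0 < N := by exact_mod_cast hN0
  -- The normalization of the density need not be computed: `studentT` is the law of a random
  -- vector, and `N > 0` supplies one.
  have hprob : MeasureTheory.IsProbabilityMeasure (studentT d σ ν) := by
    rw [← (hlaw ⟨0, hNpos⟩).map_eq]
    exact MeasureTheory.Measure.isProbabilityMeasure_map (hlaw ⟨0, hNpos⟩).aemeasurable
  set M := ∫ w, featureGram x w ∂(studentT d σ ν) with hM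
  have hM1 : ‖M - 1‖ ≤ η := norm_integral_featureGram_sub_one_le x hσ hν hκ hη.le hsep hprof
  have hYm : MeasureTheory.StronglyMeasurable (featureGram x) :=
    (continuous_featureGram x).stronglyMeasurable
  have hMH : M.IsHermitian := Matrix.isHermitian_integral (isHermitian_featureGram x)
  -- Here `R = m`, and `c = 2` because `‖M - 1‖ ≤ η < 1`. The choice `t = η / (8 m)` minimizes the
  -- exponent `4 N m t² - t η N`; its value `-η² N / (16 m)` is the source of `C = 16`.
  have htail := measureReal_le_norm_centeredSum (μ := studentT d σ ν) (ι := Fin N)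
    hYm (norm_featureGram_le x) (isHermitian_featureGram x) (featureGram_mul_self x)
    (Nat.cast_nonneg m) zero_le_two
    (Matrix.posSemidef_two_smul_one_sub hMH (hM1.trans hη1.le)) (t := η / (8 * m))
    (by positivity) (by field_simp; linarith) (η * N)
  have hbound : 2 * (Fintype.card (Fin m) : ℝ) * Real.exp (2 * 2 * (Fintype.card (Fin N) : ℝ) * m
      * (η / (8 * m)) ^ 2 - η / (8 * m) * (η * N)) ≤ δ := by
    have e1 : 2 * 2 * (Fintype.card (Fin N) : ℝ) * m * (η / (8 * m)) ^ 2 - η / (8 * m) * (η * N)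
        = -(η ^ 2 * N / (16 * m)) := by
      rw [Fintype.card_fin]; field_simp; ring
    have e2 : Real.log (2 * m / δ) ≤ η ^ 2 * N / (16 * m) := by
      rw [le_div_iff₀ (by positivity)]
      calc _ = η ^ 2 * (16 * η⁻¹ ^ 2 * m * Real.log (2 * m / δ)) := by field_simp
        _ ≤ _ := by gcongr
    rw [e1, Fintype.card_fin]
    calc 2 * (m : ℝ) * Real.exp (-(η ^ 2 * N / (16 * m)))
        ≤ 2 * (m : ℝ) * Real.exp (-Real.log (2 * m / δ)) := by gcongr
      _ = δ := by
        rw [Real.exp_neg, Real.exp_log (by positivity)]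
        field_simp
  have hmap : P.map (fun s k => ω k s) = MeasureTheory.Measure.pi fun _ => studentT d σ ν := by
    rw [(ProbabilityTheory.iIndepFun_iff_map_fun_eq_pi_map
      (fun k => (hlaw k).aemeasurable)).1 hind]
    simp only [(hlaw _).map_eq]
  have hSm : Measurable fun w : Fin N → EuclideanSpace ℝ (Fin d) =>
      ‖centeredSum (studentT d σ ν) (featureGram x) w‖ :=
    (stronglyMeasurable_centeredSum hYm).norm.measurable
  have hgood : ENNReal.ofReal (1 - δ) ≤ (MeasureTheory.Measure.pi fun _ => studentT d σ ν)
      {w : Fin N → EuclideanSpace ℝ (Fin d) |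
        η * N ≤ ‖centeredSum (studentT d σ ν) (featureGram x) w‖}ᶜ := by
    rw [← MeasureTheory.ofReal_measureReal, MeasureTheory.probReal_compl_eq_one_sub
      (measurableSet_le measurable_const hSm)]
    exact ENNReal.ofReal_le_ofReal (by linarith [htail.trans hbound])
  rw [← hmap, MeasureTheory.Measure.map_apply_of_aemeasurable
    (aemeasurable_pi_lambda _ fun k => (hlaw k).aemeasurable)
    (measurableSet_le measurable_const hSm).compl] at hgood
  refine hgood.trans (MeasureTheory.measure_mono fun s hs => ?_)
  simp only [Set.mem_preimage, Set.mem_compl_iff, Set.mem_ofPred_eq, not_le] at hs ⊢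
  set w : Fin N → EuclideanSpace ℝ (Fin d) := fun k => ω k s with hw
  have hdecomp : (1 / (N : ℂ)) • (featureMatrix x w * (featureMatrix x w).conjTranspose) - 1
      = (1 / (N : ℂ)) • centeredSum (studentT d σ ν) (featureGram x) w + (M - 1) := by
    have hNC : (N : ℂ) ≠ 0 := by exact_mod_cast hNpos.ne'
    rw [featureMatrix_mul_conjTranspose, centeredSum, Finset.sum_sub_distrib, smul_sub,
      Finset.sum_const, Finset.card_univ, Fintype.card_fin, ← Nat.cast_smul_eq_nsmul ℂ, smul_smul,
      one_div, inv_mul_cancel₀ hNC, one_smul]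
    abel
  rw [hdecomp]
  refine (norm_add_le _ _).trans ?_
  have : ‖(1 / (N : ℂ)) • centeredSum (studentT d σ ν) (featureGram x) w‖ ≤ η := by
    rw [norm_smul, norm_div, norm_one, Complex.norm_natCast, one_div, inv_mul_le_iff₀ hN0]
    linarith
  linarith
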